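/- Let $n\in\mathbb N$. Let $(M,g)$ be one of the following two Riemannian manifolds (open subsets of $\mathbb R^n$ with their Baran metrics, represented by a matrix $G(x)$ in the standard coordinates): - the ball $B^n=\{x\in\mathbb R^n: |x|<1\}$ with $G(x)_{ij}=\delta_{ij}+\dfrac{x_ix_j}{1-\sum_{k}x_k^2}$; - the simplex $S^n=\{x\in\mathbb R^n: x_i>0 \text{ for all } i,\ \sum_i x_i<1\}$ with $G(x)_{ij}=\dfrac{\delta_{ij}}{x_i}+\dfrac{1}{1-\sum_k x_k}$. Let $d\mathrm{Vol}_g=\sqrt{\det G(x)}\,dx$, let $(\operatorname{grad}u)^i=\sum_j (G^{-1})_{ij}\,\partial_j u$, and for real-valued $u\in C^\infty(M)$ put $$\|u\|_{1,2}=\Big(\int_M |u|^2\,d\mathrm{Vol}_g\Big)^{1/2}+\Big(\int_M \langle \operatorname{grad}u,\operatorname{grad}u\rangle_g\,d\mathrm{Vol}_g\Big)^{1/2}.$$ Let $C^\infty_{1,2}(M)=\{u\in C^\infty(M):\|u\|_{1,2}<\infty\}$, and let $C^\infty_b(M)$ be the set of all $u\in C^\infty(M)$ which are bounded on $M$ together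 with all their partial derivatives $\partial^\alpha u$ of every order (the bound may depend on the order). Let $H^1(M,g)$ be the closure of $C^\infty_{1,2}(M)$ with respect to $\|\cdot\|_{1,2}$ in $L^2(M,\mathrm{Vol}_g)$: it consists of the functions $u\in L^2(M,\mathrm{Vol}_g)$ for which there are a measurable vector field $X$ (the gradient of $u$) and functions $\varphi_k\in C^\infty_{1,2}(M)$ with $$\Big(\int_M|u-\varphi_k|^2\,d\mathrm{Vol}_g\Big)^{1/2}+\Big(\int_M\langle X-\operatorname{grad}\varphi_k,X-\operatorname{grad}\varphi_k\rangle_g\,d\mathrm{Vol}_g\Big)^{1/2}\to0,$$ and its norm is $\Big(\int_M|u|^2\,d\mathrm{Vol}_g\Big)^{1/2}+\Big(\int_M\langle X,X\rangle_g\,d\mathrm{Vol}_g\Big)^{1/2}$. Then $C^\infty_b(M)$ is contained and dense in $C^\infty_{1,2}(M)$ with respect to the norm $\|\cdot\|_{1,2}$. Consequently $C^\infty_b(M)$ is contained and dense in $H^1(M,g)$. -/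

import Mathlib

open scoped ContDiff ENNReal Topology Matrix
open MeasureTheory Filter

namespace Baran

/-- The open Euclidean unit ball `Bⁿ = {x ∈ ℝⁿ : |x| < 1}`. -/
def ball (n : ℕ) : Set (EuclideanSpace ℝ (Fin n)) := {x | ‖x‖ < 1}

/-- The open simplex `Sⁿ = {x ∈ ℝⁿ : x_i > 0 for all i, ∑ x_i < 1}`. -/
def simplex (n : ℕ) : Set (EuclideanSpace ℝ (Fin n)) := {x | (∀ i, 0 < x i) ∧ ∑ i, x i < 1}

/-- The matrix of the Baran metric of the ball:
`G(x)_{ij} = δ_{ij} + x_i x_j / (1 - ∑ x_k²)`. -/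
noncomputable def ballMetric (n : ℕ) (x : EuclideanSpace ℝ (Fin n)) : Matrix (Fin n) (Fin n) ℝ :=
  Matrix.of fun i j => (if i = j then 1 else 0) + x i * x j / (1 - ∑ k, x k ^ 2)

/-- The matrix of the Baran metric of the simplex:
`G(x)_{ij} = δ_{ij} / x_i + 1 / (1 - ∑ x_k)`. -/
noncomputable def simplexMetric (n : ℕ) (x : EuclideanSpace ℝ (Fin n)) :
    Matrix (Fin n) (Fin n) ℝ :=
  Matrix.of fun i j => (if i = j then (x i)⁻¹ else 0) + 1 / (1 - ∑ k, x k)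

section General

/- Below, `M` is an open subset of `ℝⁿ` with a Riemannian metric represented, in the standard
coordinates and at each point of `M`, by the matrix `G x`. A function on `M` is represented by a
function on `ℝⁿ` whose values outside `M` play no role. -/

variable {n : ℕ} (M : Set (EuclideanSpace ℝ (Fin n)))
  (G : EuclideanSpace ℝ (Fin n) → Matrix (Fin n) (Fin n) ℝ)

/-- The Riemannian volume `√(det G(x)) dx` on `M`. -/
noncomputable def vol : Measure (EuclideanSpace ℝ (Fin n)) :=
  (volume.restrict M).withDensity fun x => ENNReal.ofReal (Real.sqrt (G x).det)

/-- The Riemannian gradient `(grad u)^i = ∑_j g^{ij} ∂_j u`. -/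
noncomputable def grad (u : EuclideanSpace ℝ (Fin n) → ℝ) (x : EuclideanSpace ℝ (Fin n)) :
    Fin n → ℝ :=
  (G x)⁻¹ *ᵥ fun j => fderiv ℝ u x (EuclideanSpace.single j 1)

/-- For a function `u` and a vector field `X` on `M`, the number
`(∫ |u|² dVol_g)^{1/2} + (∫ ⟨X, X⟩_g dVol_g)^{1/2}` in `[0, ∞]`. -/
noncomputable def pairNorm (u : EuclideanSpace ℝ (Fin n) → ℝ)
    (X : EuclideanSpace ℝ (Fin n) → Fin n → ℝ) : ℝ≥0∞ :=
  (∫⁻ x, ENNReal.ofReal (|u x| ^ 2) ∂(vol M G)) ^ (1 / 2 : ℝ) +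
    (∫⁻ x, ENNReal.ofReal (X x ⬝ᵥ (G x *ᵥ X x)) ∂(vol M G)) ^ (1 / 2 : ℝ)

/-- `‖u‖_{1,2} = (∫ |u|² dVol_g)^{1/2} + (∫ |grad u|² dVol_g)^{1/2}`, for smooth `u`. -/
noncomputable def norm12 (u : EuclideanSpace ℝ (Fin n) → ℝ) : ℝ≥0∞ :=
  pairNorm M G u (grad G u)

/-- The smooth functions on `M` with `‖u‖_{1,2} < ∞`. -/
def CInfty12 : Set (EuclideanSpace ℝ (Fin n) → ℝ) :=
  {u | ContDiffOn ℝ ∞ u M ∧ norm12 M G u < ⊤}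

/-- The smooth functions on `M` that are bounded on `M` together with their partial derivatives
of each order. -/
def CInftyB : Set (EuclideanSpace ℝ (Fin n) → ℝ) :=
  {u | ContDiffOn ℝ ∞ u M ∧ ∀ k : ℕ, ∃ C : ℝ, ∀ x ∈ M, ‖iteratedFDeriv ℝ k u x‖ ≤ C}

/-- `X` is the `H¹`-gradient of `u`: `(u, X)` is the limit, in the norm
`(∫ |u|² dVol_g)^{1/2} + (∫ ⟨X, X⟩_g dVol_g)^{1/2}`, of pairs `(φ_k, grad φ_k)` with `φ_k` smooth
and `‖φ_k‖_{1,2} < ∞`. -/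
def IsH1Gradient (u : EuclideanSpace ℝ (Fin n) → ℝ)
    (X : EuclideanSpace ℝ (Fin n) → Fin n → ℝ) : Prop :=
  AEStronglyMeasurable u (vol M G) ∧ AEStronglyMeasurable X (vol M G) ∧
    ∃ φ : ℕ → EuclideanSpace ℝ (Fin n) → ℝ, (∀ k, φ k ∈ CInfty12 M G) ∧
      Tendsto (fun k => pairNorm M G (u - φ k) (X - grad G (φ k))) atTop (𝓝 0)

/-- The Sobolev space `H¹(M, g)`: the closure, with respect to `‖·‖_{1,2}`, of the smooth functions
of finite norm in the space of square integrable functions. The norm of `u` in this space is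
`pairNorm M G u X`, where `X` is the `H¹`-gradient of `u`. -/
def H1 : Set (EuclideanSpace ℝ (Fin n) → ℝ) := {u | ∃ X, IsH1Gradient M G u X}

end General

end Baran

/-! Both manifolds are regions where finitely many face functions `ℓ i` are positive: `1 - |x|²` for
the ball; the `x i` and `1 - ∑ x k` for the simplex. The volume density is `∏ ℓ_i^{-1/2}`, and the
inverse metric `A` is polynomial, hence continuous up to the boundary. A function `u` is
approximated by `u ∘ T_s` with `T_s x = a s • x + b s` and small `s > 0`. Since `T_s` carries the
compact set `{ℓ ≥ 0}` into `M`, `u ∘ T_s` lies in `CInftyB`. The structure `Shrinking` collects the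
properties used.

On compact subsets of `M`, `u ∘ T_s → u` with first derivatives; the issue is to keep the energy
near the boundary small. Pointwise, `|grad (u ∘ T_s)|² ≤ |grad u|² ∘ T_s` by `contract`. The
push-forward of the volume, however, is only controlled by `∏ (ℓ_i - s_i)^{-1/2}`, which is singular
on the shifted faces and not bounded by a multiple of `∏ ℓ_i^{-1/2}`. Averaging over `s_i ∈ (0, δ]`
removes this: the mean of `(t - s)^{-1/2}` is at most `2 t^{-1/2}`. Hence for each integrand some
small `s` is good (`exists_lintegral_comp_le`). Applying this to the energy density of `u` in a thin
boundary strip gives `exists_lintegral_density_sub_lt`. The same averaging shows that the volume is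
finite, and the statement for `H1` follows by approximating twice. -/

namespace Baran

/-! ### Averages of shifted inverse square roots -/

/-- The function `t ↦ t^{-1/2}`, extended by zero to `t ≤ 0`. -/
noncomputable def invSqrt (t : ℝ) : ℝ≥0∞ := ENNReal.ofReal (√t)⁻¹

theorem measurable_invSqrt : Measurable invSqrt := by
  unfold invSqrt; fun_prop

theorem invSqrt_of_nonpos {t : ℝ} (ht : t ≤ 0) : invSqrt t = 0 := by
  simp [invSqrt, Real.sqrt_eq_zero_of_nonpos ht]

theorem invSqrt_lt_top (t : ℝ) : invSqrt t < ⊤ := ENNReal.ofReal_lt_top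

theorem invSqrt_anti {s t : ℝ} (hs : 0 < s) (h : s ≤ t) : invSqrt t ≤ invSqrt s := by
  unfold invSqrt
  have := Real.sqrt_pos.2 hs
  gcongr

theorem lintegral_invSqrt_sub {t m : ℝ} (hm : 0 ≤ m) (hmt : m ≤ t) :
    ∫⁻ s in Set.Ioc 0 m, invSqrt (t - s) = ENNReal.ofReal (2 * (√t - √(t - m))) := by
  have hrp : ∀ x : ℝ, 0 ≤ x → (√x)⁻¹ = x ^ (-1 / 2 : ℝ) := fun x hx => by
    rw [Real.sqrt_eq_rpow, ← Real.rpow_neg hx]; norm_num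
  have hint : IntervalIntegrable (fun x : ℝ => x ^ (-1 / 2 : ℝ)) volume (t - 0) (t - m) :=
    intervalIntegral.intervalIntegrable_rpow' (by norm_num)
  have hint' : IntervalIntegrable (fun s : ℝ => (t - s) ^ (-1 / 2 : ℝ)) volume 0 m := by
    simpa using hint.comp_sub_left t
  have h1 : ∫⁻ s in Set.Ioc 0 m, invSqrt (t - s) =
      ∫⁻ s in Set.Ioc 0 m, ENNReal.ofReal ((t - s) ^ (-1 / 2 : ℝ)) :=
    setLIntegral_congr_fun measurableSet_Ioc fun s hs => by
      rw [invSqrt, hrp _ (by linarith [hs.2])]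
  rw [h1, ← ofReal_integral_eq_lintegral_ofReal
    ((intervalIntegrable_iff_integrableOn_Ioc_of_le hm).1 hint')
    ((ae_restrict_iff' measurableSet_Ioc).2 (ae_of_all _ fun s hs =>
      Real.rpow_nonneg (by linarith [hs.2]) _)), ← intervalIntegral.integral_of_le hm,
    intervalIntegral.integral_comp_sub_left (fun x : ℝ => x ^ (-1 / 2 : ℝ)) t,
    integral_rpow (Or.inl (by norm_num))]
  congr 1
  rw [Real.sqrt_eq_rpow, Real.sqrt_eq_rpow]
  norm_num
  ring

/-- The first bound, which has no singularity, yields finiteness of the volume; the second compares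
the averaged weight with the original one. -/
theorem lintegral_invSqrt_sub_le {t δ : ℝ} (hδ : 0 < δ) :
    ∫⁻ s in Set.Ioc 0 δ, invSqrt (t - s) ≤ ENNReal.ofReal (2 * √t) ∧
      ∫⁻ s in Set.Ioc 0 δ, invSqrt (t - s) ≤ ENNReal.ofReal (2 * δ) * invSqrt t := by
  rcases le_or_gt t 0 with ht | ht
  · have : ∫⁻ s in Set.Ioc 0 δ, invSqrt (t - s) = 0 := by
      rw [setLIntegral_congr_fun (g := fun _ => 0) measurableSet_Ioc fun s hs =>
        invSqrt_of_nonpos (by linarith [hs.1])]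
      simp
    simp [this]
  · have h0 : ∫⁻ s in Set.Ioc 0 δ, invSqrt (t - s) =
        ∫⁻ s in Set.Ioc 0 (min δ t), invSqrt (t - s) := by
      rw [← lintegral_indicator measurableSet_Ioc, ← lintegral_indicator measurableSet_Ioc]
      refine lintegral_congr fun s => ?_
      by_cases hs : s ∈ Set.Ioc 0 (min δ t)
      · rw [Set.indicator_of_mem hs,
          Set.indicator_of_mem (Set.mem_Ioc.2 ⟨hs.1, hs.2.trans (min_le_left _ _)⟩)]
      · rw [Set.indicator_of_notMem hs]
        by_cases hs' : s ∈ Set.Ioc 0 δ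
        · rw [Set.indicator_of_mem hs']
          refine invSqrt_of_nonpos ?_
          by_contra hc
          exact hs ⟨hs'.1, le_min hs'.2 (by linarith)⟩
        · rw [Set.indicator_of_notMem hs']
    have hm : min δ t ≤ t := min_le_right _ _
    have hm0 : 0 ≤ min δ t := le_min hδ.le ht.le
    rw [h0, lintegral_invSqrt_sub hm0 hm]
    refine ⟨ENNReal.ofReal_le_ofReal (by linarith [Real.sqrt_nonneg (t - min δ t)]), ?_⟩
    rw [invSqrt, ← ENNReal.ofReal_mul (by positivity)]
    apply ENNReal.ofReal_le_ofReal
    have hst := Real.sqrt_pos.2 ht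
    rw [← div_eq_mul_inv, le_div_iff₀ hst]
    have e1 := Real.mul_self_sqrt ht.le
    have e2 := Real.mul_self_sqrt (sub_nonneg.2 hm)
    have e3 : √(t - min δ t) ≤ √t := Real.sqrt_le_sqrt (by linarith)
    -- With `m = min δ t`: `(√t - √(t - m)) √t ≤ (√t - √(t - m)) (√t + √(t - m)) = m ≤ δ`.
    nlinarith [Real.sqrt_nonneg (t - min δ t), min_le_left δ t]

/-- The uniform probability measure on `(0, δ]`. -/
noncomputable def unif (δ : ℝ) : Measure ℝ :=
  (ENNReal.ofReal δ)⁻¹ • volume.restrict (Set.Ioc 0 δ)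

theorem isProbabilityMeasure_unif {δ : ℝ} (hδ : 0 < δ) : IsProbabilityMeasure (unif δ) := by
  refine ⟨?_⟩
  have : ENNReal.ofReal δ ≠ 0 := by simpa using hδ
  simp [unif, ENNReal.inv_mul_cancel this]

theorem lintegral_unif_le {t δ : ℝ} (hδ : 0 < δ) :
    ∫⁻ s, invSqrt (t - s) ∂unif δ ≤ (ENNReal.ofReal δ)⁻¹ * ENNReal.ofReal (2 * √t) ∧
      ∫⁻ s, invSqrt (t - s) ∂unif δ ≤ 2 * invSqrt t := by
  have hδ' : ENNReal.ofReal δ ≠ 0 := by simpa using hδ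
  obtain ⟨h1, h2⟩ := lintegral_invSqrt_sub_le (t := t) hδ
  rw [unif, lintegral_smul_measure, smul_eq_mul]
  refine ⟨by gcongr, ?_⟩
  calc _ ≤ (ENNReal.ofReal δ)⁻¹ * (ENNReal.ofReal (2 * δ) * invSqrt t) := by gcongr
    _ = ((ENNReal.ofReal δ)⁻¹ * ENNReal.ofReal δ) * (2 * invSqrt t) := by
      rw [ENNReal.ofReal_mul (by norm_num)]
      simp only [ENNReal.ofReal_ofNat]
      ring
    _ = _ := by rw [ENNReal.inv_mul_cancel hδ' ENNReal.ofReal_ne_top, one_mul]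

/-- The coordinates are independent under the product measure. -/
theorem lintegral_pi_unif_prod {ι : Type*} [Fintype ι] {δ : ℝ} (hδ : 0 < δ) (t : ι → ℝ) :
    ∫⁻ s, ∏ i, invSqrt (t i - s i) ∂(Measure.pi fun _ : ι => unif δ) =
      ∏ i, ∫⁻ s, invSqrt (t i - s) ∂unif δ := by
  have := isProbabilityMeasure_unif hδ
  have hm : ∀ i, Measurable fun s => invSqrt (t i - s) := fun i =>
    measurable_invSqrt.comp (measurable_const.sub measurable_id)
  rw [ProbabilityTheory.lintegral_prod_eq_prod_lintegral_of_indepFun Finset.univ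
    (fun i (s : ι → ℝ) => invSqrt (t i - s i))
    (ProbabilityTheory.iIndepFun_pi (X := fun i s => invSqrt (t i - s))
      fun i => (hm i).aemeasurable) fun i => (hm i).comp (measurable_pi_apply i)]
  refine Finset.prod_congr rfl fun i _ => ?_
  exact (measurePreserving_eval (fun _ : ι => unif δ) i).lintegral_comp (hm i)

theorem ae_pi_unif {ι : Type*} [Fintype ι] {δ : ℝ} (hδ : 0 < δ) :
    ∀ᵐ s ∂(Measure.pi fun _ : ι => unif δ), ∀ i, s i ∈ Set.Ioc 0 δ := by
  have := isProbabilityMeasure_unif hδ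
  rw [ae_all_iff]
  intro i
  have h : ∀ᵐ r ∂unif δ, r ∈ Set.Ioc 0 δ :=
    Measure.ae_smul_measure (ae_restrict_mem measurableSet_Ioc) _
  exact (measurePreserving_eval (fun _ : ι => unif δ) i).quasiMeasurePreserving.ae h

/-! ### The volume under affine shrinking maps -/

/-- The density `∏ ℓ_i^{-1/2}` on the region where all `ℓ_i` are positive, zero elsewhere. -/
noncomputable def weight {n : ℕ} {ι : Type*} [Fintype ι] (ℓ : ι → EuclideanSpace ℝ (Fin n) → ℝ)
    (x : EuclideanSpace ℝ (Fin n)) : ℝ≥0∞ := ∏ i, invSqrt (ℓ i x)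

/-- The manifold `M = {x | ℓ_i x > 0 for all i}` with volume density `∏ ℓ_i^{-1/2}` and inverse
metric `A`, together with a family of affine maps `x ↦ a s • x + b s` that move `M` away from each
of the faces `ℓ_i = 0` by the amount `s_i` and do not increase the energy of functions. -/
structure Shrinking {n : ℕ} {ι : Type*} [Fintype ι] (M : Set (EuclideanSpace ℝ (Fin n)))
    (G A : EuclideanSpace ℝ (Fin n) → Matrix (Fin n) (Fin n) ℝ)
    (ℓ : ι → EuclideanSpace ℝ (Fin n) → ℝ) (a : (ι → ℝ) → ℝ)
    (b : (ι → ℝ) → EuclideanSpace ℝ (Fin n)) : Prop where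
  continuous_face : ∀ i, Continuous (ℓ i)
  isBounded : Bornology.IsBounded {x | ∀ i, 0 ≤ ℓ i x}
  mem_iff : ∀ x, x ∈ M ↔ ∀ i, 0 < ℓ i x
  sqrt_det : ∀ x ∈ M, √(G x).det = ∏ i, (√(ℓ i x))⁻¹
  continuous_inv : Continuous A
  mul_inv : ∀ x ∈ M, G x * A x = 1
  inv_nonneg : ∀ x ∈ M, ∀ p : Fin n → ℝ, 0 ≤ p ⬝ᵥ A x *ᵥ p
  continuous_scale : Continuous a
  continuous_shift : Continuous b
  scale_zero : a 0 = 1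
  shift_zero : b 0 = 0
  face_map : ∀ s : ι → ℝ, (∀ i, 0 ≤ s i) → ∑ i, s i ≤ 1 / 2 → ∀ i x,
    ℓ i (a s • x + b s) = (1 - ∑ j, s j) * ℓ i x + s i
  contract : ∀ s : ι → ℝ, (∀ i, 0 ≤ s i) → ∑ i, s i ≤ 1 / 2 → ∀ x ∈ M, ∀ p : Fin n → ℝ,
    a s ^ 2 * (p ⬝ᵥ A x *ᵥ p) ≤ p ⬝ᵥ A (a s • x + b s) *ᵥ p

theorem lintegral_comp_affine {n : ℕ} {r : ℝ} (hr : 0 < r) (v : EuclideanSpace ℝ (Fin n))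
    {g : EuclideanSpace ℝ (Fin n) → ℝ≥0∞} (hg : Measurable g) :
    ∫⁻ x, g (r • x + v) = ENNReal.ofReal (r ^ n)⁻¹ * ∫⁻ y, g y := by
  have h1 : ∀ x, r • x + v = r • (x + r⁻¹ • v) := fun x => by
    rw [smul_add, smul_inv_smul₀ hr.ne']
  simp_rw [h1]
  rw [lintegral_add_right_eq_self (fun x => g (r • x)) (r⁻¹ • v),
    ← lintegral_map hg (measurable_const_smul r), Measure.map_addHaar_smul volume hr.ne',
    lintegral_smul_measure, finrank_euclideanSpace_fin, abs_of_pos (by positivity), smul_eq_mul]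

namespace Shrinking

variable {n : ℕ} {ι : Type*} [Fintype ι] {M : Set (EuclideanSpace ℝ (Fin n))}
    {G A : EuclideanSpace ℝ (Fin n) → Matrix (Fin n) (Fin n) ℝ}
    {ℓ : ι → EuclideanSpace ℝ (Fin n) → ℝ} {a : (ι → ℝ) → ℝ}
    {b : (ι → ℝ) → EuclideanSpace ℝ (Fin n)}

theorem isOpen (H : Shrinking M G A ℓ a b) : IsOpen M := by
  have : M = ⋂ i, {x | 0 < ℓ i x} := by ext x; simp [H.mem_iff]
  rw [this]
  exact isOpen_iInter_of_finite fun i => isOpen_lt continuous_const (H.continuous_face i)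

theorem isCompact_le (H : Shrinking M G A ℓ a b) {η : ℝ} (hη : 0 ≤ η) :
    IsCompact {x | ∀ i, η ≤ ℓ i x} := by
  refine Metric.isCompact_of_isClosed_isBounded ?_
    (H.isBounded.subset fun x hx i => hη.trans (hx i))
  rw [Set.ofPred_forall]
  exact isClosed_iInter fun i => isClosed_le continuous_const (H.continuous_face i)

theorem subset_closed (H : Shrinking M G A ℓ a b) : M ⊆ {x | ∀ i, 0 ≤ ℓ i x} :=
  fun x hx i => ((H.mem_iff x).1 hx i).le

theorem measurable_weight (H : Shrinking M G A ℓ a b) : Measurable (weight ℓ) := by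
  unfold weight
  exact Finset.measurable_fun_prod _ fun i _ =>
    measurable_invSqrt.comp (H.continuous_face i).measurable

theorem weight_of_notMem (H : Shrinking M G A ℓ a b) {x : EuclideanSpace ℝ (Fin n)} (hx : x ∉ M) :
    weight ℓ x = 0 := by
  rw [H.mem_iff] at hx
  push Not at hx
  obtain ⟨i, hi⟩ := hx
  exact Finset.prod_eq_zero (Finset.mem_univ i) (invSqrt_of_nonpos hi)

/-- The weight vanishes off `M` because `invSqrt` is zero on `t ≤ 0`, so the restriction to `M` is
automatic. -/
theorem vol_eq (H : Shrinking M G A ℓ a b) : vol M G = volume.withDensity (weight ℓ) := by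
  have h1 : M.indicator (weight ℓ) = weight ℓ := by
    ext x
    by_cases hx : x ∈ M
    · rw [Set.indicator_of_mem hx]
    · rw [Set.indicator_of_notMem hx, H.weight_of_notMem hx]
  rw [vol, ← h1, withDensity_indicator H.isOpen.measurableSet]
  refine withDensity_congr_ae ((ae_restrict_iff' H.isOpen.measurableSet).2 (ae_of_all _ ?_))
  intro x hx
  simp only [weight, invSqrt]
  rw [H.sqrt_det x hx, ENNReal.ofReal_prod_of_nonneg fun i _ => by positivity]

theorem lintegral_vol (H : Shrinking M G A ℓ a b) (F : EuclideanSpace ℝ (Fin n) → ℝ≥0∞) :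
    ∫⁻ x, F x ∂vol M G = ∫⁻ x, weight ℓ x * F x := by
  rw [H.vol_eq, lintegral_withDensity_eq_lintegral_mul_non_measurable _ H.measurable_weight
    (ae_of_all _ fun x => ENNReal.prod_lt_top fun i _ => invSqrt_lt_top _)]
  rfl

theorem ae_mem (H : Shrinking M G A ℓ a b) : ∀ᵐ x ∂vol M G, x ∈ M :=
  (withDensity_absolutelyContinuous _ _).ae_le (ae_restrict_mem H.isOpen.measurableSet)

/-- Substitute `y = T_s x`. The Jacobian factor is `(a s)^{-n} ≤ 2^n`, and `ℓ_i (T_s x) - s_i = (1 -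
∑ s) ℓ_i x ≤ ℓ_i x` bounds the weight at `x` by the shifted weight at `y`. -/
theorem lintegral_comp_le (H : Shrinking M G A ℓ a b) {s : ι → ℝ} (hs : ∀ i, 0 ≤ s i)
    (hs1 : ∑ i, s i ≤ 1 / 2) (ha : 1 / 2 ≤ a s) {F : EuclideanSpace ℝ (Fin n) → ℝ≥0∞}
    (hF : Measurable F) :
    ∫⁻ x, F (a s • x + b s) ∂vol M G ≤
      2 ^ n * ∫⁻ y, (∏ i, invSqrt (ℓ i y - s i)) * F y := by
  have ha0 : 0 < a s := by linarith
  have hm : Measurable fun y => (∏ i, invSqrt (ℓ i y - s i)) * F y :=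
    (Finset.measurable_fun_prod _ fun i _ =>
      measurable_invSqrt.comp ((H.continuous_face i).measurable.sub measurable_const)).mul hF
  have hs0 : 0 ≤ ∑ i, s i := Finset.sum_nonneg fun i _ => hs i
  have hc : ENNReal.ofReal (a s ^ n)⁻¹ ≤ 2 ^ n := by
    have : (a s ^ n)⁻¹ ≤ 2 ^ n := by
      rw [← inv_pow]
      gcongr
      rw [inv_le_comm₀ ha0 two_pos]
      linarith
    calc _ ≤ ENNReal.ofReal (2 ^ n) := ENNReal.ofReal_le_ofReal this
      _ = 2 ^ n := by rw [ENNReal.ofReal_pow two_pos.le]; simp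
  rw [H.lintegral_vol]
  calc _ ≤ ∫⁻ x, (∏ i, invSqrt (ℓ i (a s • x + b s) - s i)) * F (a s • x + b s) := by
        refine lintegral_mono fun x => ?_
        simp only [weight]
        gcongr with i
        rw [H.face_map s hs hs1, add_sub_cancel_right]
        rcases le_or_gt (ℓ i x) 0 with hl | hl
        · rw [invSqrt_of_nonpos hl]; exact zero_le
        · exact invSqrt_anti (by nlinarith) (by nlinarith)
    _ = ENNReal.ofReal (a s ^ n)⁻¹ * ∫⁻ y, (∏ i, invSqrt (ℓ i y - s i)) * F y :=
        lintegral_comp_affine ha0 (b s) hm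
    _ ≤ _ := by gcongr

theorem measurable_shifted_weight (H : Shrinking M G A ℓ a b)
    {F : EuclideanSpace ℝ (Fin n) → ℝ≥0∞} (hF : Measurable F) :
    Measurable (Function.uncurry fun (s : ι → ℝ) (y : EuclideanSpace ℝ (Fin n)) =>
      (∏ i, invSqrt (ℓ i y - s i)) * F y) := by
  refine Measurable.mul (Finset.measurable_fun_prod _ fun i _ => measurable_invSqrt.comp ?_)
    (hF.comp measurable_snd)
  exact ((H.continuous_face i).measurable.comp measurable_snd).sub
    ((measurable_pi_apply i).comp measurable_fst)

theorem measurable_lintegral_shifted_weight (H : Shrinking M G A ℓ a b)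
    {F : EuclideanSpace ℝ (Fin n) → ℝ≥0∞} (hF : Measurable F) :
    Measurable fun s : ι → ℝ => ∫⁻ y, (∏ i, invSqrt (ℓ i y - s i)) * F y :=
  (H.measurable_shifted_weight hF).lintegral_prod_right

theorem lintegral_pi_unif_shifted_weight (H : Shrinking M G A ℓ a b) {δ : ℝ} (hδ : 0 < δ)
    {F : EuclideanSpace ℝ (Fin n) → ℝ≥0∞} (hF : Measurable F) :
    ∫⁻ s, ∫⁻ y, (∏ i, invSqrt (ℓ i y - s i)) * F y ∂volume ∂(Measure.pi fun _ : ι => unif δ) =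
      ∫⁻ y, (∏ i, ∫⁻ r, invSqrt (ℓ i y - r) ∂unif δ) * F y := by
  have := isProbabilityMeasure_unif hδ
  rw [lintegral_lintegral_swap (H.measurable_shifted_weight hF).aemeasurable]
  refine lintegral_congr fun y => ?_
  have hm : Measurable fun s : ι → ℝ => ∏ i, invSqrt (ℓ i y - s i) :=
    Finset.measurable_fun_prod _ fun i _ => measurable_invSqrt.comp
      (measurable_const.sub (measurable_pi_apply i))
  rw [lintegral_mul_const (F y) hm, lintegral_pi_unif_prod hδ fun i => ℓ i y]

theorem exists_cube (H : Shrinking M G A ℓ a b) {U : Set (ι → ℝ)} (hU : U ∈ 𝓝 0) :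
    ∃ δ > 0, ∀ s : ι → ℝ, (∀ i, s i ∈ Set.Ioc 0 δ) →
      s ∈ U ∧ ∑ i, s i ≤ 1 / 2 ∧ 1 / 2 ≤ a s := by
  have h1 : ∀ᶠ s : ι → ℝ in 𝓝 0, ∑ i, s i < 1 / 2 :=
    (continuous_finsetSum _ fun i _ => continuous_apply i).continuousAt.eventually_lt
      continuousAt_const (by simp)
  have h2 : ∀ᶠ s : ι → ℝ in 𝓝 0, 1 / 2 < a s :=
    continuousAt_const.eventually_lt H.continuous_scale.continuousAt
      (by rw [H.scale_zero]; norm_num)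
  obtain ⟨δ, hδ, h⟩ := Metric.mem_nhds_iff.1 (inter_mem (inter_mem hU h1) h2)
  refine ⟨δ / 2, half_pos hδ, fun s hs => ?_⟩
  have : s ∈ Metric.ball 0 δ := by
    rw [mem_ball_zero_iff, pi_norm_lt_iff hδ]
    intro i
    rw [Real.norm_of_nonneg (hs i).1.le]
    linarith [(hs i).2]
  obtain ⟨⟨ha, hb⟩, hc⟩ := h this
  exact ⟨ha, le_of_lt hb, le_of_lt hc⟩

/-- The volume of `M` is finite. -/
theorem vol_univ_lt_top (H : Shrinking M G A ℓ a b) : vol M G Set.univ < ⊤ := by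
  obtain ⟨δ, hδ, hcube⟩ := H.exists_cube univ_mem
  have := isProbabilityMeasure_unif hδ
  have hswap := H.lintegral_pi_unif_shifted_weight hδ (F := fun _ => 1) measurable_const
  have hmeas := H.measurable_lintegral_shifted_weight (F := fun _ => 1) measurable_const
  -- A parameter at which the integral does not exceed its mean, chosen off the null set where some
  -- `s i` leaves `(0, δ]`.
  obtain ⟨s, hs, hle⟩ := exists_notMem_null_le_lintegral hmeas.aemeasurable (ae_pi_unif (ι := ι) hδ)
  simp only [Set.mem_compl_iff, not_not] at hs
  obtain ⟨-, hs1, hs2⟩ := hcube s hs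
  have h1 := H.lintegral_comp_le (fun i => (hs i).1.le) hs1 hs2 (F := fun _ => 1) measurable_const
  rw [lintegral_one] at h1
  refine h1.trans_lt (ENNReal.mul_lt_top (by simp) (hle.trans_lt ?_))
  rw [hswap]
  have hK := H.isCompact_le le_rfl
  set K := {x | ∀ i, 0 ≤ ℓ i x}
  have hcont : Continuous fun y => ∏ i, 2 * √(ℓ i y) :=
    continuous_finsetProd _ fun i _ => continuous_const.mul (H.continuous_face i).sqrt
  obtain ⟨C, hC⟩ := hK.exists_bound_of_continuousOn hcont.continuousOn
  -- The averaged weight is bounded on the compact set `K` and vanishes outside it.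
  calc _ ≤ ∫⁻ y, K.indicator (fun _ =>
        (ENNReal.ofReal δ)⁻¹ ^ Fintype.card ι * ENNReal.ofReal C) y := by
        refine lintegral_mono fun y => ?_
        by_cases hy : y ∈ K
        · rw [Set.indicator_of_mem hy, mul_one]
          calc _ ≤ ∏ i, (ENNReal.ofReal δ)⁻¹ * ENNReal.ofReal (2 * √(ℓ i y)) :=
                Finset.prod_le_prod' fun i _ => (lintegral_unif_le hδ).1
            _ = (ENNReal.ofReal δ)⁻¹ ^ Fintype.card ι *
                  ENNReal.ofReal (∏ i, 2 * √(ℓ i y)) := by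
                rw [Finset.prod_mul_distrib, Finset.prod_const, Finset.card_univ,
                  ENNReal.ofReal_prod_of_nonneg fun i _ => by positivity]
            _ ≤ _ := by
                gcongr
                exact (Real.le_norm_self _).trans (hC y hy)
        · have : ∃ i, ℓ i y < 0 := by simpa [K] using hy
          obtain ⟨i, hi⟩ := this
          rw [Finset.prod_eq_zero (Finset.mem_univ i), zero_mul]
          · exact zero_le
          · refine le_antisymm ((lintegral_unif_le hδ).2.trans ?_) zero_le
            rw [invSqrt_of_nonpos hi.le, mul_zero]
    _ < ⊤ := by
        rw [lintegral_indicator_const hK.measurableSet]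
        refine ENNReal.mul_lt_top (ENNReal.mul_lt_top (ENNReal.pow_lt_top ?_)
          ENNReal.ofReal_lt_top) hK.measure_lt_top
        simpa using hδ

/-- Among the maps `x ↦ a s • x + b s` with small `s` there is one whose push-forward of the volume
does not increase a given integral by more than a constant factor. -/
theorem exists_lintegral_comp_le (H : Shrinking M G A ℓ a b) {U : Set (ι → ℝ)} (hU : U ∈ 𝓝 0)
    {F : EuclideanSpace ℝ (Fin n) → ℝ≥0∞} (hF : Measurable F) :
    ∃ s ∈ U, (∀ i, 0 < s i) ∧ ∑ i, s i ≤ 1 / 2 ∧ 1 / 2 ≤ a s ∧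
      ∫⁻ x, F (a s • x + b s) ∂vol M G ≤
        2 ^ n * 2 ^ Fintype.card ι * ∫⁻ x, F x ∂vol M G := by
  obtain ⟨δ, hδ, hcube⟩ := H.exists_cube hU
  have := isProbabilityMeasure_unif hδ
  have hswap := H.lintegral_pi_unif_shifted_weight hδ hF
  have hmeas := H.measurable_lintegral_shifted_weight hF
  obtain ⟨s, hs, hle⟩ := exists_notMem_null_le_lintegral hmeas.aemeasurable (ae_pi_unif (ι := ι) hδ)
  simp only [Set.mem_compl_iff, not_not] at hs
  obtain ⟨hs0, hs1, hs2⟩ := hcube s hs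
  refine ⟨s, hs0, fun i => (hs i).1, hs1, hs2, ?_⟩
  refine (H.lintegral_comp_le (fun i => (hs i).1.le) hs1 hs2 hF).trans ?_
  rw [mul_assoc]
  gcongr
  refine hle.trans ?_
  rw [hswap, H.lintegral_vol,
    ← lintegral_const_mul (2 ^ Fintype.card ι)
      (show Measurable fun x => weight ℓ x * F x from H.measurable_weight.mul hF)]
  refine lintegral_mono fun y => ?_
  rw [← mul_assoc]
  gcongr
  calc _ ≤ ∏ i, 2 * invSqrt (ℓ i y) := Finset.prod_le_prod' fun i _ => (lintegral_unif_le hδ).2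
    _ = _ := by rw [Finset.prod_mul_distrib, Finset.prod_const, Finset.card_univ, weight]

end Shrinking

/-! ### Partial derivatives and energy density -/

/-- The vector of the partial derivatives of `u`. -/
noncomputable def partials {n : ℕ} (u : EuclideanSpace ℝ (Fin n) → ℝ)
    (x : EuclideanSpace ℝ (Fin n)) : Fin n → ℝ :=
  fun j => fderiv ℝ u x (EuclideanSpace.single j 1)

theorem continuousAt_partials {n : ℕ} {u : EuclideanSpace ℝ (Fin n) → ℝ}
    {x : EuclideanSpace ℝ (Fin n)} (hu : ContDiffAt ℝ ∞ u x) : ContinuousAt (partials u) x :=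
  continuousAt_pi.2 fun _ =>
    (hu.continuousAt_fderiv (by simp)).clm_apply continuousAt_const

theorem partials_sub {n : ℕ} {u v : EuclideanSpace ℝ (Fin n) → ℝ} {x : EuclideanSpace ℝ (Fin n)}
    (hu : DifferentiableAt ℝ u x) (hv : DifferentiableAt ℝ v x) :
    partials (u - v) x = partials u x - partials v x := by
  ext j
  simp [partials, fderiv_sub hu hv]

theorem partials_comp_affine {n : ℕ} {u : EuclideanSpace ℝ (Fin n) → ℝ} {r : ℝ}
    {x v : EuclideanSpace ℝ (Fin n)} (hu : DifferentiableAt ℝ u (r • x + v)) :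
    partials (fun y => u (r • y + v)) x = r • partials u (r • x + v) := by
  have h : HasFDerivAt (fun y : EuclideanSpace ℝ (Fin n) => r • y + v)
      (r • ContinuousLinearMap.id ℝ (EuclideanSpace ℝ (Fin n))) x :=
    ((hasFDerivAt_id x).const_smul r).add_const v
  ext j
  have := (hu.hasFDerivAt.comp x h).fderiv
  simp only [Function.comp_def] at this
  simp [partials, this]

/-- Parallelogram identity, which does not require `B` to be symmetric; the nonnegative term at `p +
q` is dropped. -/
theorem dotProduct_mulVec_sub_le {m : Type*} [Fintype m] {B : Matrix m m ℝ}
    (hB : ∀ p : m → ℝ, 0 ≤ p ⬝ᵥ B *ᵥ p) (p q : m → ℝ) :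
    (p - q) ⬝ᵥ B *ᵥ (p - q) ≤ 2 * (p ⬝ᵥ B *ᵥ p) + 2 * (q ⬝ᵥ B *ᵥ q) := by
  have h := hB (p + q)
  simp only [Matrix.mulVec_add, Matrix.mulVec_sub, dotProduct_add, dotProduct_sub,
    add_dotProduct, sub_dotProduct] at h ⊢
  linarith

theorem dotProduct_mulVec_add_le {m : Type*} [Fintype m] {B : Matrix m m ℝ}
    (hB : ∀ p : m → ℝ, 0 ≤ p ⬝ᵥ B *ᵥ p) (p q : m → ℝ) :
    (p + q) ⬝ᵥ B *ᵥ (p + q) ≤ 2 * (p ⬝ᵥ B *ᵥ p) + 2 * (q ⬝ᵥ B *ᵥ q) := by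
  have h := hB (p - q)
  simp only [Matrix.mulVec_add, Matrix.mulVec_sub, dotProduct_add, dotProduct_sub,
    add_dotProduct, sub_dotProduct] at h ⊢
  linarith

theorem continuous_dotProduct_mulVec {n : ℕ}
    {A : EuclideanSpace ℝ (Fin n) → Matrix (Fin n) (Fin n) ℝ} (hA : Continuous A) :
    Continuous fun z : EuclideanSpace ℝ (Fin n) × (Fin n → ℝ) => z.2 ⬝ᵥ A z.1 *ᵥ z.2 :=
  continuous_snd.dotProduct ((hA.comp continuous_fst).matrix_mulVec continuous_snd)

/-- The density `|u|² + |grad u|²`, where `A` is the inverse of the matrix of the metric. -/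
noncomputable def density {n : ℕ} (A : EuclideanSpace ℝ (Fin n) → Matrix (Fin n) (Fin n) ℝ)
    (u : EuclideanSpace ℝ (Fin n) → ℝ) (x : EuclideanSpace ℝ (Fin n)) : ℝ :=
  |u x| ^ 2 + partials u x ⬝ᵥ A x *ᵥ partials u x

/-- A triangle inequality up to the factor 2. Additivity of the integral needs only one measurable
summand, so `g` may come from an arbitrary function or field. -/
theorem sqrt_lintegral_le_of_le {α : Type*} [MeasurableSpace α] {μ : Measure α}
    {f g h : α → ℝ≥0∞} (hh : AEMeasurable h μ) (hle : ∀ᵐ x ∂μ, f x ≤ 2 * g x + 2 * h x) :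
    (∫⁻ x, f x ∂μ) ^ (1 / 2 : ℝ) ≤
      2 * ((∫⁻ x, g x ∂μ) ^ (1 / 2 : ℝ) + (∫⁻ x, h x ∂μ) ^ (1 / 2 : ℝ)) := by
  have h2 : ∀ c : ℝ≥0∞, (2 * c) ^ (1 / 2 : ℝ) ≤ 2 * c ^ (1 / 2 : ℝ) := fun c => by
    rw [ENNReal.mul_rpow_of_nonneg _ _ (by norm_num)]
    gcongr
    calc (2 : ℝ≥0∞) ^ (1 / 2 : ℝ) ≤ 2 ^ (1 : ℝ) :=
          ENNReal.rpow_le_rpow_of_exponent_le (by norm_num) (by norm_num)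
      _ = 2 := ENNReal.rpow_one 2
  calc _ ≤ (2 * ∫⁻ x, g x ∂μ + 2 * ∫⁻ x, h x ∂μ) ^ (1 / 2 : ℝ) := by
        gcongr
        calc _ ≤ ∫⁻ x, 2 * g x + 2 * h x ∂μ := lintegral_mono_ae hle
          _ = _ := by
            rw [lintegral_add_right' _ (hh.const_mul 2), lintegral_const_mul' _ _ (by simp),
              lintegral_const_mul' _ _ (by simp)]
    _ ≤ (2 * ∫⁻ x, g x ∂μ) ^ (1 / 2 : ℝ) + (2 * ∫⁻ x, h x ∂μ) ^ (1 / 2 : ℝ) :=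
        ENNReal.rpow_add_le_add_rpow _ _ (by norm_num) (by norm_num)
    _ ≤ _ := by rw [mul_add]; exact add_le_add (h2 _) (h2 _)

theorem ofReal_le_two_mul_add {p q r : ℝ} (hq : 0 ≤ q) (hr : 0 ≤ r) (h : p ≤ 2 * q + 2 * r) :
    ENNReal.ofReal p ≤ 2 * ENNReal.ofReal q + 2 * ENNReal.ofReal r := by
  have h2 : ∀ c : ℝ, 2 * ENNReal.ofReal c = ENNReal.ofReal (2 * c) := fun c => by
    rw [ENNReal.ofReal_mul two_pos.le, ENNReal.ofReal_ofNat]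
  rw [h2, h2, ← ENNReal.ofReal_add (by positivity) (by positivity)]
  exact ENNReal.ofReal_le_ofReal h

/-! ### Approximation of smooth functions of finite norm -/

namespace Shrinking

variable {n : ℕ} {ι : Type*} [Fintype ι] {M : Set (EuclideanSpace ℝ (Fin n))}
    {G A : EuclideanSpace ℝ (Fin n) → Matrix (Fin n) (Fin n) ℝ}
    {ℓ : ι → EuclideanSpace ℝ (Fin n) → ℝ} {a : (ι → ℝ) → ℝ}
    {b : (ι → ℝ) → EuclideanSpace ℝ (Fin n)}
    {u v : EuclideanSpace ℝ (Fin n) → ℝ} {x : EuclideanSpace ℝ (Fin n)}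

theorem contDiffAt (H : Shrinking M G A ℓ a b) (hu : ContDiffOn ℝ ∞ u M) (hx : x ∈ M) :
    ContDiffAt ℝ ∞ u x := hu.contDiffAt (H.isOpen.mem_nhds hx)

theorem differentiableAt (H : Shrinking M G A ℓ a b) (hu : ContDiffOn ℝ ∞ u M) (hx : x ∈ M) :
    DifferentiableAt ℝ u x := (H.contDiffAt hu hx).differentiableAt (by simp)

theorem continuousOn_partials (H : Shrinking M G A ℓ a b) (hu : ContDiffOn ℝ ∞ u M) :
    ContinuousOn (partials u) M := fun _ hx =>
  (continuousAt_partials (H.contDiffAt hu hx)).continuousWithinAt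

theorem continuousOn_energy (H : Shrinking M G A ℓ a b) (hu : ContDiffOn ℝ ∞ u M) :
    ContinuousOn (fun x => partials u x ⬝ᵥ A x *ᵥ partials u x) M :=
  (continuous_dotProduct_mulVec H.continuous_inv).comp_continuousOn
    (continuousOn_id.prodMk (H.continuousOn_partials hu))

theorem aemeasurable (H : Shrinking M G A ℓ a b) {β : Type*} [TopologicalSpace β]
    [MeasurableSpace β] [BorelSpace β] {f : EuclideanSpace ℝ (Fin n) → β}
    (hf : ContinuousOn f M) : AEMeasurable f (vol M G) :=
  (hf.aemeasurable H.isOpen.measurableSet).mono_ac (withDensity_absolutelyContinuous _ _)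

theorem grad_eq (H : Shrinking M G A ℓ a b) (hx : x ∈ M) : grad G u x = A x *ᵥ partials u x := by
  rw [grad, Matrix.inv_eq_right_inv (H.mul_inv x hx)]
  rfl

theorem grad_sub (H : Shrinking M G A ℓ a b) (hu : ContDiffOn ℝ ∞ u M) (hv : ContDiffOn ℝ ∞ v M)
    (hx : x ∈ M) : grad G (u - v) x = grad G u x - grad G v x := by
  rw [H.grad_eq hx, H.grad_eq hx, H.grad_eq hx,
    partials_sub (H.differentiableAt hu hx) (H.differentiableAt hv hx), Matrix.mulVec_sub]

theorem energy_eq (H : Shrinking M G A ℓ a b) (hx : x ∈ M) :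
    grad G u x ⬝ᵥ (G x *ᵥ grad G u x) = partials u x ⬝ᵥ A x *ᵥ partials u x := by
  rw [H.grad_eq hx, Matrix.mulVec_mulVec, H.mul_inv x hx, Matrix.one_mulVec, dotProduct_comm]

/-- Positivity of the inverse, applied to the covector `G x *ᵥ p`. -/
theorem metric_nonneg (H : Shrinking M G A ℓ a b) (hx : x ∈ M) (p : Fin n → ℝ) :
    0 ≤ p ⬝ᵥ G x *ᵥ p := by
  have h := H.inv_nonneg x hx (G x *ᵥ p)
  rwa [Matrix.mulVec_mulVec, mul_eq_one_comm.1 (H.mul_inv x hx), Matrix.one_mulVec,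
    dotProduct_comm] at h

theorem norm12_eq (H : Shrinking M G A ℓ a b) : norm12 M G u =
    (∫⁻ x, ENNReal.ofReal (|u x| ^ 2) ∂(vol M G)) ^ (1 / 2 : ℝ) +
      (∫⁻ x, ENNReal.ofReal (partials u x ⬝ᵥ A x *ᵥ partials u x) ∂(vol M G)) ^ (1 / 2 : ℝ) := by
  rw [norm12, pairNorm]
  congr 2
  refine lintegral_congr_ae ?_
  filter_upwards [H.ae_mem] with x hx
  rw [H.energy_eq hx]

theorem norm12_le (H : Shrinking M G A ℓ a b) : norm12 M G u ≤
    2 * (∫⁻ x, ENNReal.ofReal (density A u x) ∂(vol M G)) ^ (1 / 2 : ℝ) := by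
  rw [H.norm12_eq, two_mul]
  gcongr ?_ ^ _ + ?_ ^ _
  · refine lintegral_mono_ae ?_
    filter_upwards [H.ae_mem] with x hx
    exact ENNReal.ofReal_le_ofReal (le_add_of_nonneg_right (H.inv_nonneg x hx _))
  · exact lintegral_mono fun x => ENNReal.ofReal_le_ofReal (le_add_of_nonneg_left (by positivity))

theorem lintegral_density_ne_top (H : Shrinking M G A ℓ a b) (hu : u ∈ CInfty12 M G) :
    ∫⁻ x, ENNReal.ofReal (density A u x) ∂(vol M G) ≠ ⊤ := by
  obtain ⟨hc, hn⟩ := hu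
  rw [H.norm12_eq, ENNReal.add_lt_top, ENNReal.rpow_lt_top_iff_of_pos (by norm_num),
    ENNReal.rpow_lt_top_iff_of_pos (by norm_num)] at hn
  refine ne_top_of_le_ne_top (ENNReal.add_lt_top.2 hn).ne ?_
  rw [← lintegral_add_right' _ (H.aemeasurable (H.continuousOn_energy hc)).ennreal_ofReal]
  exact lintegral_mono fun x => ENNReal.ofReal_add_le

theorem density_nonneg (H : Shrinking M G A ℓ a b) (hx : x ∈ M) : 0 ≤ density A u x :=
  add_nonneg (by positivity) (H.inv_nonneg x hx _)

theorem density_sub_le (H : Shrinking M G A ℓ a b) (hu : ContDiffOn ℝ ∞ u M)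
    (hv : ContDiffOn ℝ ∞ v M) (hx : x ∈ M) :
    density A (u - v) x ≤ 2 * density A u x + 2 * density A v x := by
  have h1 := dotProduct_mulVec_sub_le (H.inv_nonneg x hx) (partials u x) (partials v x)
  unfold density
  rw [partials_sub (H.differentiableAt hu hx) (H.differentiableAt hv hx), Pi.sub_apply]
  simp only [sq_abs]
  nlinarith [sq_nonneg (u x + v x)]

theorem map_mem (H : Shrinking M G A ℓ a b) {s : ι → ℝ} (hs : ∀ i, 0 < s i)
    (hs1 : ∑ i, s i ≤ 1 / 2) (hx : ∀ i, 0 ≤ ℓ i x) : a s • x + b s ∈ M := by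
  rw [H.mem_iff]
  intro i
  rw [H.face_map s (fun i => (hs i).le) hs1]
  have := hx i
  have := hs i
  have : 0 ≤ (1 - ∑ j, s j) * ℓ i x := mul_nonneg (by linarith) (hx i)
  linarith

/-- The chain rule produces the factor `a s ^ 2` that `contract` absorbs. -/
theorem density_comp_le (H : Shrinking M G A ℓ a b) (hu : ContDiffOn ℝ ∞ u M) {s : ι → ℝ}
    (hs : ∀ i, 0 < s i) (hs1 : ∑ i, s i ≤ 1 / 2) (hx : x ∈ M) :
    density A (fun y => u (a s • y + b s)) x ≤ density A u (a s • x + b s) := by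
  have hTx := H.map_mem hs hs1 (H.subset_closed hx)
  have h := H.contract s (fun i => (hs i).le) hs1 x hx (partials u (a s • x + b s))
  unfold density
  rw [partials_comp_affine (H.differentiableAt hu hTx), Matrix.mulVec_smul, smul_dotProduct,
    dotProduct_smul, smul_eq_mul, smul_eq_mul, ← mul_assoc, ← sq]
  linarith

/-- The composition is smooth on an open neighbourhood `U` of the compact set `{ℓ ≥ 0} ⊇ M`, so each
derivative is bounded there. -/
theorem comp_mem_CInftyB (H : Shrinking M G A ℓ a b) (hu : ContDiffOn ℝ ∞ u M) {s : ι → ℝ}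
    (hs : ∀ i, 0 < s i) (hs1 : ∑ i, s i ≤ 1 / 2) :
    (fun y => u (a s • y + b s)) ∈ CInftyB M := by
  have hT : ContDiff ℝ ∞ fun y : EuclideanSpace ℝ (Fin n) => a s • y + b s := by fun_prop
  set U := (fun y : EuclideanSpace ℝ (Fin n) => a s • y + b s) ⁻¹' M
  have hU : IsOpen U := H.isOpen.preimage hT.continuous
  have hsub : {x | ∀ i, 0 ≤ ℓ i x} ⊆ U := fun x hx => H.map_mem hs hs1 hx
  have hv : ContDiffOn ℝ ∞ (fun y => u (a s • y + b s)) U :=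
    hu.comp hT.contDiffOn fun _ hx => hx
  refine ⟨hv.mono (H.subset_closed.trans hsub), fun k => ?_⟩
  have hc : ContinuousOn (iteratedFDeriv ℝ k fun y => u (a s • y + b s)) U :=
    (hv.continuousOn_iteratedFDerivWithin (m := k) (mod_cast le_top) hU.uniqueDiffOn).congr
      fun x hx => (iteratedFDerivWithin_of_isOpen k hU hx).symm
  obtain ⟨C, hC⟩ := (H.isCompact_le le_rfl).exists_bound_of_continuousOn (hc.mono hsub)
  exact ⟨C, fun x hx => hC x (H.subset_closed hx)⟩

/-- The boundary strips decrease to the empty set and the volume is finite; absolute continuity of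
the integral does the rest. -/
theorem exists_lintegral_near_boundary_le (H : Shrinking M G A ℓ a b)
    {f : EuclideanSpace ℝ (Fin n) → ℝ≥0∞} (hf : ∫⁻ x, f x ∂vol M G ≠ ⊤) {t : ℝ≥0∞} (ht : 0 < t) :
    ∃ η > 0, ∫⁻ x in M \ {x | ∀ i, η ≤ ℓ i x}, f x ∂vol M G ≤ t := by
  let S : ℕ → Set (EuclideanSpace ℝ (Fin n)) := fun k =>
    M \ {x | ∀ i, 1 / ((k : ℝ) + 1) ≤ ℓ i x}
  have hSm : ∀ k, MeasurableSet (S k) := fun k =>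
    H.isOpen.measurableSet.diff (H.isCompact_le (by positivity)).measurableSet
  have hanti : Antitone S := fun k l hkl x hx => ⟨hx.1, fun h => hx.2 fun i =>
    (one_div_le_one_div_of_le (by positivity) (by exact_mod_cast Nat.succ_le_succ hkl)).trans
      (h i)⟩
  have hempty : ⋂ k, S k = ∅ := by
    refine Set.eq_empty_iff_forall_notMem.2 fun x hx => ?_
    rw [Set.mem_iInter] at hx
    have hxM := (H.mem_iff x).1 (hx 0).1
    have : ∀ᶠ k : ℕ in atTop, ∀ i, 1 / ((k : ℝ) + 1) ≤ ℓ i x :=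
      eventually_all.2 fun i =>
        (tendsto_one_div_add_atTop_nhds_zero_nat.eventually_lt_const (hxM i)).mono
          fun k hk => hk.le
    obtain ⟨k, hk⟩ := this.exists
    exact (hx k).2 hk
  have h0 : Tendsto (vol M G ∘ S) atTop (𝓝 0) := by
    have := tendsto_measure_iInter_atTop (μ := vol M G)
      (fun k => (hSm k).nullMeasurableSet) hanti
      ⟨0, ((measure_mono (Set.subset_univ _)).trans_lt H.vol_univ_lt_top).ne⟩
    rwa [hempty, measure_empty] at this
  obtain ⟨k, hk⟩ := ((tendsto_setLIntegral_zero hf h0).eventually_le_const ht).exists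
  exact ⟨1 / ((k : ℝ) + 1), by positivity, hk⟩

theorem eventually_density_sub_comp_lt (H : Shrinking M G A ℓ a b) (hu : ContDiffOn ℝ ∞ u M)
    {K : Set (EuclideanSpace ℝ (Fin n))} (hK : IsCompact K) (hKM : K ⊆ M) {t : ℝ} (ht : 0 < t) :
    ∀ᶠ s in 𝓝 (0 : ι → ℝ), (∀ i, 0 < s i) → ∑ i, s i ≤ 1 / 2 → ∀ x ∈ K,
      density A (u - fun y => u (a s • y + b s)) x < t := by
  -- The chain rule is written out, so that `h` is jointly continuous at `(0, x)` without any sign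
  -- condition on `s`; it agrees with the density for admissible `s`. Compactness of `K` then gives
  -- uniformity in `x`.
  let h : (ι → ℝ) → EuclideanSpace ℝ (Fin n) → ℝ := fun s x =>
    |u x - u (a s • x + b s)| ^ 2 + (partials u x - a s • partials u (a s • x + b s)) ⬝ᵥ
      A x *ᵥ (partials u x - a s • partials u (a s • x + b s))
  have key : ∀ᶠ s in 𝓝 (0 : ι → ℝ), ∀ x ∈ K, h s x < t := by
    refine hK.eventually_forall_of_forall_eventually fun x hx => ?_
    have hxM := hKM hx
    have hT : Continuous fun z : (ι → ℝ) × EuclideanSpace ℝ (Fin n) => a z.1 • z.2 + b z.1 :=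
      ((H.continuous_scale.comp continuous_fst).smul continuous_snd).add
        (H.continuous_shift.comp continuous_fst)
    have hT0 : a (0 : ι → ℝ) • x + b 0 = x := by rw [H.scale_zero, H.shift_zero]; simp
    have hu0 := (H.contDiffAt hu hxM).continuousAt
    have hp0 := continuousAt_partials (H.contDiffAt hu hxM)
    have c1 : ContinuousAt (fun z : (ι → ℝ) × EuclideanSpace ℝ (Fin n) => u z.2) (0, x) :=
      ContinuousAt.comp_of_eq hu0 continuousAt_snd rfl
    have c2 : ContinuousAt (fun z : (ι → ℝ) × EuclideanSpace ℝ (Fin n) =>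
        u (a z.1 • z.2 + b z.1)) (0, x) :=
      ContinuousAt.comp_of_eq hu0 hT.continuousAt hT0
    have c3 : ContinuousAt (fun z : (ι → ℝ) × EuclideanSpace ℝ (Fin n) => partials u z.2) (0, x) :=
      ContinuousAt.comp_of_eq hp0 continuousAt_snd rfl
    have c4 : ContinuousAt (fun z : (ι → ℝ) × EuclideanSpace ℝ (Fin n) =>
        partials u (a z.1 • z.2 + b z.1)) (0, x) :=
      ContinuousAt.comp_of_eq hp0 hT.continuousAt hT0
    have c5 := c3.sub ((H.continuous_scale.comp continuous_fst).continuousAt.smul c4)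
    have c6 := ((c1.sub c2).abs.pow 2).add
      ((continuous_dotProduct_mulVec H.continuous_inv).continuousAt.comp
        (continuousAt_snd.prodMk c5))
    refine (c6.eventually_lt continuousAt_const ?_)
    simpa [hT0, H.scale_zero, H.shift_zero] using ht
  filter_upwards [key] with s hs hs0 hs1 x hx
  have hTx := H.map_mem hs0 hs1 (H.subset_closed (hKM hx))
  have hv := (H.comp_mem_CInftyB hu hs0 hs1).1
  have := hs x hx
  rwa [density, partials_sub (H.differentiableAt hu (hKM hx)) (H.differentiableAt hv (hKM hx)),
    partials_comp_affine (H.differentiableAt hu hTx), Pi.sub_apply]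

/-- On a compact `K` the difference is uniformly small. Off `K` it is at most `2 F + 2 F ∘ T_s`,
where `F` is the density of `u` in the strip `S`, and `s` is chosen so that the integral of `F ∘
T_s` is controlled by that of `F`. -/
theorem exists_lintegral_density_sub_lt (H : Shrinking M G A ℓ a b) (hu : u ∈ CInfty12 M G)
    {ε : ℝ≥0∞} (hε : 0 < ε) :
    ∃ v ∈ CInftyB M, ∫⁻ x, ENNReal.ofReal (density A (u - v) x) ∂(vol M G) < ε := by
  set C : ℝ≥0∞ := 2 ^ n * 2 ^ Fintype.card ι
  have hC : C ≠ ⊤ := by finiteness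
  -- The compact part will contribute `t * vol`, the strip `2 * t + 2 * C * t`.
  obtain ⟨t, ht, htε⟩ := ENNReal.exists_nnreal_pos_mul_lt
    (a := vol M G Set.univ + (2 + 2 * C)) (b := ε)
    (ENNReal.add_ne_top.2 ⟨H.vol_univ_lt_top.ne, by finiteness⟩) hε.ne'
  obtain ⟨η, hη, hηt⟩ := H.exists_lintegral_near_boundary_le (H.lintegral_density_ne_top hu)
    (t := t) (by exact_mod_cast ht)
  have hcu := hu.1
  set S := M \ {x | ∀ i, η ≤ ℓ i x}
  have hS : MeasurableSet S :=
    H.isOpen.measurableSet.diff (H.isCompact_le hη.le).measurableSet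
  set F := S.indicator fun x => ENNReal.ofReal (density A u x)
  have hFm : Measurable F := by
    classical
    have hcont : ContinuousOn (fun x => ENNReal.ofReal (density A u x)) S :=
      ENNReal.continuous_ofReal.comp_continuousOn
        (((hcu.continuousOn.abs.pow 2).add (H.continuousOn_energy hcu)).mono Set.sdiff_subset)
    have := hcont.measurable_piecewise (g := 0) continuousOn_const hS
    rwa [Set.piecewise_eq_indicator] at this
  have hFint : ∫⁻ x, F x ∂vol M G ≤ t := by rwa [lintegral_indicator hS]
  -- Half of `η` leaves room for the shift: if `ℓ_i x < η / 2` and `s_i < η / 2`, then `ℓ_i (T_s x)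
  -- < η`, so `T_s` sends `M \ K` into `S`.
  set K := {x | ∀ i, η / 2 ≤ ℓ i x}
  have hK : IsCompact K := H.isCompact_le (by positivity)
  have hKM : K ⊆ M := fun x hx => (H.mem_iff x).2 fun i => (half_pos hη).trans_le (hx i)
  have hsmall : ∀ᶠ s in 𝓝 (0 : ι → ℝ), ∀ i, s i < η / 2 :=
    eventually_all.2 fun i => (continuous_apply i).continuousAt.eventually_lt continuousAt_const
      (by simpa using hη)
  obtain ⟨s, ⟨hsU, hsη⟩, hs0, hs1, -, hsF⟩ := H.exists_lintegral_comp_le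
    (inter_mem (H.eventually_density_sub_comp_lt hcu hK hKM (t := t) (by exact_mod_cast ht))
      hsmall) hFm
  have hvB := H.comp_mem_CInftyB hcu hs0 hs1
  refine ⟨_, hvB, lt_of_le_of_lt ?_ htε⟩
  have hKc : ∀ᵐ x ∂(vol M G).restrict Kᶜ,
      ENNReal.ofReal (density A (u - fun y => u (a s • y + b s)) x) ≤
        2 * F x + 2 * F (a s • x + b s) := by
    filter_upwards [ae_restrict_mem hK.measurableSet.compl, ae_restrict_of_ae H.ae_mem] with x hxK hx
    have hTx := H.map_mem hs0 hs1 (H.subset_closed hx)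
    obtain ⟨i, hi⟩ : ∃ i, ℓ i x < η / 2 := by simpa [K] using hxK
    have hxS : x ∈ S := ⟨hx, fun h => by linarith [h i]⟩
    have hTxS : a s • x + b s ∈ S := ⟨hTx, fun h => by
      have h1 := h i
      rw [H.face_map s (fun i => (hs0 i).le) hs1] at h1
      have h2 : 0 ≤ ∑ j, s j := Finset.sum_nonneg fun i _ => (hs0 i).le
      have h3 : s i < η / 2 := hsη i
      nlinarith [(H.mem_iff x).1 hx i]⟩
    simp only [F, Set.indicator_of_mem hxS, Set.indicator_of_mem hTxS]
    refine ofReal_le_two_mul_add (H.density_nonneg hx) (H.density_nonneg hTx) ?_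
    linarith [H.density_sub_le hcu hvB.1 hx, H.density_comp_le hcu hs0 hs1 hx]
  rw [← lintegral_add_compl _ hK.measurableSet, mul_add]
  refine add_le_add ?_ ?_
  · calc _ ≤ ∫⁻ x in K, (t : ℝ≥0∞) ∂vol M G := by
          refine setLIntegral_mono measurable_const fun x hx => ?_
          rw [← ENNReal.ofReal_coe_nnreal]
          exact ENNReal.ofReal_le_ofReal (hsU hs0 hs1 x hx).le
      _ = t * vol M G K := setLIntegral_const _ _
      _ ≤ _ := by gcongr; exact Set.subset_univ _
  · calc _ ≤ ∫⁻ x in Kᶜ, 2 * F x + 2 * F (a s • x + b s) ∂vol M G := lintegral_mono_ae hKc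
      _ ≤ ∫⁻ x, 2 * F x + 2 * F (a s • x + b s) ∂vol M G := setLIntegral_le_lintegral _ _
      _ = 2 * ∫⁻ x, F x ∂vol M G + 2 * ∫⁻ x, F (a s • x + b s) ∂vol M G := by
          rw [lintegral_add_left (hFm.const_mul 2), lintegral_const_mul' _ _ (by simp),
            lintegral_const_mul' _ _ (by simp)]
      _ ≤ 2 * t + 2 * (C * t) := by
          gcongr
          exact hsF.trans (by gcongr)
      _ = _ := by ring

theorem exists_norm12_sub_lt (H : Shrinking M G A ℓ a b) (hu : u ∈ CInfty12 M G)
    {ε : ℝ≥0∞} (hε : 0 < ε) : ∃ v ∈ CInftyB M, norm12 M G (u - v) < ε := by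
  have hcont : Tendsto (fun r : ℝ≥0∞ => 2 * r ^ (1 / 2 : ℝ)) (𝓝 0) (𝓝 0) := by
    have := ENNReal.Tendsto.const_mul (a := 2)
      ((ENNReal.continuous_rpow_const (y := 1 / 2)).tendsto 0) (Or.inr (by simp))
    simpa using this
  obtain ⟨η, hη, hηε⟩ := ENNReal.nhds_zero_basis.mem_iff.1 (hcont.eventually_lt_const hε)
  obtain ⟨v, hv, hlt⟩ := H.exists_lintegral_density_sub_lt hu hη
  exact ⟨v, hv, H.norm12_le.trans_lt (hηε hlt)⟩

theorem CInftyB_subset (H : Shrinking M G A ℓ a b) : CInftyB M ⊆ CInfty12 M G := by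
  intro u hu
  obtain ⟨hc, hb⟩ := hu
  refine ⟨hc, ?_⟩
  obtain ⟨C0, hC0⟩ := hb 0
  obtain ⟨C1, hC1⟩ := hb 1
  -- The energy is a continuous function of the point and the partial derivatives, which range over
  -- a compact product. The maximum with 0 makes the radius nonnegative.
  obtain ⟨D, hD⟩ := ((H.isCompact_le le_rfl).prod
    (isCompact_closedBall (0 : Fin n → ℝ) (max C1 0))).exists_bound_of_continuousOn
    (continuous_dotProduct_mulVec H.continuous_inv).continuousOn
  have hfin : ∀ c : ℝ, (∫⁻ _, ENNReal.ofReal c ∂vol M G) ^ (1 / 2 : ℝ) < ⊤ := fun c => by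
    rw [lintegral_const]
    exact ENNReal.rpow_lt_top_of_nonneg (by norm_num)
      (ENNReal.mul_lt_top ENNReal.ofReal_lt_top H.vol_univ_lt_top).ne
  rw [H.norm12_eq]
  refine lt_of_le_of_lt (add_le_add ?_ ?_) (ENNReal.add_lt_top.2 ⟨hfin (C0 ^ 2), hfin D⟩)
  · gcongr ?_ ^ _
    refine lintegral_mono_ae ?_
    filter_upwards [H.ae_mem] with x hx
    apply ENNReal.ofReal_le_ofReal
    have := hC0 x hx
    rw [norm_iteratedFDeriv_zero, Real.norm_eq_abs] at this
    gcongr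
  · gcongr ?_ ^ _
    refine lintegral_mono_ae ?_
    filter_upwards [H.ae_mem] with x hx
    apply ENNReal.ofReal_le_ofReal
    refine (Real.le_norm_self _).trans (hD (x, partials u x) ⟨H.subset_closed hx, ?_⟩)
    rw [mem_closedBall_zero_iff, pi_norm_le_iff_of_nonneg (le_max_right _ _)]
    intro j
    have h1 := hC1 x hx
    rw [norm_iteratedFDeriv_one] at h1
    refine ((fderiv ℝ u x).le_opNorm _).trans ?_
    rw [PiLp.norm_single, norm_one, mul_one]
    exact h1.trans (le_max_left _ _)

/-! ### Passage to the Sobolev space -/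

theorem aestronglyMeasurable_grad (H : Shrinking M G A ℓ a b) (hu : ContDiffOn ℝ ∞ u M) :
    AEStronglyMeasurable (grad G u) (vol M G) := by
  have hc : ContinuousOn (grad G u) M :=
    ((continuous_fst.matrix_mulVec continuous_snd).comp_continuousOn
      (H.continuous_inv.continuousOn.prodMk (H.continuousOn_partials hu))).congr
      fun x hx => H.grad_eq hx
  exact (H.aemeasurable hc).aestronglyMeasurable

theorem CInftyB_subset_H1 (H : Shrinking M G A ℓ a b) : CInftyB M ⊆ H1 M G := by
  intro u hu
  refine ⟨grad G u, (H.aemeasurable hu.1.continuousOn).aestronglyMeasurable,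
    H.aestronglyMeasurable_grad hu.1, fun _ => u, fun _ => H.CInftyB_subset hu, ?_⟩
  simp [pairNorm]

theorem pairNorm_sub_le (H : Shrinking M G A ℓ a b) {w : EuclideanSpace ℝ (Fin n) → ℝ}
    {X : EuclideanSpace ℝ (Fin n) → Fin n → ℝ} (hu : ContDiffOn ℝ ∞ u M)
    (hv : ContDiffOn ℝ ∞ v M) :
    pairNorm M G (w - v) (X - grad G v) ≤
      2 * (pairNorm M G (w - u) (X - grad G u) + norm12 M G (u - v)) := by
  rw [H.norm12_eq, pairNorm, pairNorm, add_add_add_comm, mul_add]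
  refine add_le_add (sqrt_lintegral_le_of_le ?_ ?_) (sqrt_lintegral_le_of_le ?_ ?_)
  · exact (H.aemeasurable ((hu.sub hv).continuousOn.abs.pow 2)).ennreal_ofReal
  · refine ae_of_all _ fun x => ofReal_le_two_mul_add (by positivity) (by positivity) ?_
    simp only [sq_abs, Pi.sub_apply]
    nlinarith [sq_nonneg (w x - u x - (u x - v x))]
  · exact (H.aemeasurable (H.continuousOn_energy (hu.sub hv))).ennreal_ofReal
  · filter_upwards [H.ae_mem] with x hx
    refine ofReal_le_two_mul_add (H.metric_nonneg hx _) (H.inv_nonneg x hx _) ?_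
    rw [← H.energy_eq hx]
    have he : (X - grad G v) x = (X - grad G u) x + grad G (u - v) x := by
      rw [H.grad_sub hu hv hx, Pi.sub_apply, Pi.sub_apply]; abel
    rw [he]
    exact dotProduct_mulVec_add_le (H.metric_nonneg hx) _ _

theorem exists_pairNorm_sub_lt (H : Shrinking M G A ℓ a b)
    {X : EuclideanSpace ℝ (Fin n) → Fin n → ℝ} (hX : IsH1Gradient M G u X)
    {ε : ℝ≥0∞} (hε : 0 < ε) :
    ∃ v ∈ CInftyB M, pairNorm M G (u - v) (X - grad G v) < ε := by
  obtain ⟨-, -, φ, hφ, hlim⟩ := hX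
  -- Two errors below `t`, doubled by `pairNorm_sub_le`, make `4 * t`.
  obtain ⟨t, ht, htε⟩ := ENNReal.exists_nnreal_pos_mul_lt (a := 4) (b := ε) (by simp) hε.ne'
  have ht' : (0 : ℝ≥0∞) < t := by exact_mod_cast ht
  obtain ⟨k, hk⟩ := (hlim.eventually_lt_const ht').exists
  obtain ⟨v, hv, hlt⟩ := H.exists_norm12_sub_lt (hφ k) ht'
  refine ⟨v, hv, ((H.pairNorm_sub_le (hφ k).1 hv.1).trans ?_).trans_lt htε⟩
  calc _ ≤ 2 * ((t : ℝ≥0∞) + t) := by gcongr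
    _ = t * 4 := by ring

end Shrinking

/-! ### The ball and the simplex -/

theorem sq_sum_mul_le {ι : Type*} [Fintype ι] {y : ι → ℝ} (hy : ∀ i, 0 ≤ y i) (p : ι → ℝ) :
    (∑ i, y i * p i) ^ 2 ≤ (∑ i, y i) * ∑ i, y i * p i ^ 2 :=
  Finset.sum_sq_le_sum_mul_sum_of_sq_le_mul _ (fun i _ => hy i)
    (fun i _ => mul_nonneg (hy i) (sq_nonneg _)) fun i _ => le_of_eq (by ring)

/-- The inverse of the matrix of the Baran metric of the ball. -/
noncomputable def ballInv (n : ℕ) (x : EuclideanSpace ℝ (Fin n)) : Matrix (Fin n) (Fin n) ℝ :=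
  Matrix.of fun i j => (if i = j then 1 else 0) - x i * x j

/-- The inverse of the matrix of the Baran metric of the simplex. -/
noncomputable def simplexInv (n : ℕ) (x : EuclideanSpace ℝ (Fin n)) :
    Matrix (Fin n) (Fin n) ℝ :=
  Matrix.of fun i j => (if i = j then x i else 0) - x i * x j

theorem dotProduct_ballInv {n : ℕ} (x : EuclideanSpace ℝ (Fin n)) (p : Fin n → ℝ) :
    p ⬝ᵥ ballInv n x *ᵥ p = ∑ i, p i ^ 2 - (∑ i, x i * p i) ^ 2 := by
  simp only [dotProduct, Matrix.mulVec, ballInv, Matrix.of_apply, sub_mul, ite_mul, one_mul,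
    zero_mul, Finset.sum_sub_distrib, Finset.sum_ite_eq, Finset.mem_univ, if_true, mul_sub]
  congr 1
  · exact Finset.sum_congr rfl fun i _ => by ring
  · rw [sq, Finset.sum_mul]
    refine Finset.sum_congr rfl fun i _ => ?_
    simp only [Finset.mul_sum]
    exact Finset.sum_congr rfl fun j _ => by ring

theorem dotProduct_simplexInv {n : ℕ} (x : EuclideanSpace ℝ (Fin n)) (p : Fin n → ℝ) :
    p ⬝ᵥ simplexInv n x *ᵥ p = ∑ i, x i * p i ^ 2 - (∑ i, x i * p i) ^ 2 := by
  simp only [dotProduct, Matrix.mulVec, simplexInv, Matrix.of_apply, sub_mul, ite_mul,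
    zero_mul, Finset.sum_sub_distrib, Finset.sum_ite_eq, Finset.mem_univ, if_true, mul_sub]
  congr 1
  · exact Finset.sum_congr rfl fun i _ => by ring
  · rw [sq, Finset.sum_mul]
    refine Finset.sum_congr rfl fun i _ => ?_
    simp only [Finset.mul_sum]
    exact Finset.sum_congr rfl fun j _ => by ring

theorem ballMetric_mul_ballInv {n : ℕ} {x : EuclideanSpace ℝ (Fin n)}
    (hx : 1 - ∑ k, x k ^ 2 ≠ 0) : ballMetric n x * ballInv n x = 1 := by
  have h : ∀ i j, (ballMetric n x * ballInv n x) i j = (if i = j then 1 else 0) - x i * x j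
      + (x i * x j / (1 - ∑ k, x k ^ 2) -
        x i * x j / (1 - ∑ k, x k ^ 2) * ∑ k, x k ^ 2) := fun i j => by
    simp only [Matrix.mul_apply, ballMetric, ballInv, Matrix.of_apply, add_mul, mul_sub, ite_mul,
      one_mul, zero_mul, mul_ite, mul_one, mul_zero, Finset.sum_add_distrib,
      Finset.sum_sub_distrib, Finset.sum_ite_eq, Finset.sum_ite_eq', Finset.mem_univ, if_true]
    have : ∑ k, x i * x k / (1 - ∑ k, x k ^ 2) * (x k * x j) =
        x i * x j / (1 - ∑ k, x k ^ 2) * ∑ k, x k ^ 2 := by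
      rw [Finset.mul_sum]
      exact Finset.sum_congr rfl fun k _ => by ring
    rw [this]
    ring
  ext i j
  rw [h, Matrix.one_apply]
  field_simp
  ring

theorem simplexMetric_mul_simplexInv {n : ℕ} {x : EuclideanSpace ℝ (Fin n)}
    (hx : ∀ i, x i ≠ 0) (hx' : 1 - ∑ k, x k ≠ 0) : simplexMetric n x * simplexInv n x = 1 := by
  have h : ∀ i j, (simplexMetric n x * simplexInv n x) i j =
      ((x i)⁻¹ * (if i = j then x i else 0) - (x i)⁻¹ * (x i * x j)) +
      (1 / (1 - ∑ k, x k) * x j - 1 / (1 - ∑ k, x k) * x j * ∑ k, x k) := fun i j => by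
    simp only [Matrix.mul_apply, simplexMetric, simplexInv, Matrix.of_apply, add_mul, mul_sub,
      ite_mul, zero_mul, mul_ite, mul_zero, Finset.sum_add_distrib,
      Finset.sum_sub_distrib, Finset.sum_ite_eq, Finset.sum_ite_eq', Finset.mem_univ, if_true]
    have : ∑ k, 1 / (1 - ∑ k, x k) * (x k * x j) =
        1 / (1 - ∑ k, x k) * x j * ∑ k, x k := by
      rw [Finset.mul_sum]
      exact Finset.sum_congr rfl fun k _ => by ring
    rw [this]
    split_ifs with hij
    · subst hij; ring
    · ring
  ext i j
  rw [h, Matrix.one_apply]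
  have := hx i
  split_ifs <;> field_simp <;> ring

/-- The metric is a rank-one perturbation of the identity, so the matrix determinant lemma applies.
-/
theorem det_ballMetric {n : ℕ} {x : EuclideanSpace ℝ (Fin n)} (hx : 1 - ∑ k, x k ^ 2 ≠ 0) :
    (ballMetric n x).det = (1 - ∑ k, x k ^ 2)⁻¹ := by
  have h : ballMetric n x = 1 + Matrix.replicateCol Unit (fun i => x i / (1 - ∑ k, x k ^ 2)) *
      Matrix.replicateRow Unit (fun i => x i) := by
    ext i j
    simp only [ballMetric, Matrix.of_apply, Matrix.add_apply, Matrix.one_apply,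
      Matrix.mul_apply, Matrix.replicateCol_apply, Matrix.replicateRow_apply,
      Finset.univ_unique, Finset.sum_singleton]
    ring
  have h2 : (fun i => x i) ⬝ᵥ (fun i => x i / (1 - ∑ k, x k ^ 2)) =
      (∑ k, x k ^ 2) / (1 - ∑ k, x k ^ 2) := by
    rw [dotProduct, Finset.sum_div]
    exact Finset.sum_congr rfl fun k _ => by ring
  rw [h, Matrix.det_one_add_replicateCol_mul_replicateRow, h2]
  field_simp
  ring

theorem det_simplexMetric {n : ℕ} {x : EuclideanSpace ℝ (Fin n)} (hx : ∀ i, x i ≠ 0)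
    (hx' : 1 - ∑ k, x k ≠ 0) :
    (simplexMetric n x).det = (∏ i, (x i)⁻¹) * (1 - ∑ k, x k)⁻¹ := by
  have h : simplexMetric n x = Matrix.diagonal (fun i => (x i)⁻¹) *
      (1 + Matrix.replicateCol Unit (fun i => x i / (1 - ∑ k, x k)) *
        Matrix.replicateRow Unit (fun _ => (1 : ℝ))) := by
    ext i j
    have := hx i
    rw [Matrix.diagonal_mul]
    simp only [simplexMetric, Matrix.of_apply, Matrix.add_apply, Matrix.one_apply,
      Matrix.mul_apply, Matrix.replicateCol_apply,
      Matrix.replicateRow_apply, Finset.univ_unique, Finset.sum_singleton]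
    split_ifs <;> field_simp <;> ring
  have h2 : (fun _ => (1 : ℝ)) ⬝ᵥ (fun i => x i / (1 - ∑ k, x k)) =
      (∑ k, x k) / (1 - ∑ k, x k) := by
    simp [dotProduct, Finset.sum_div]
  rw [h, Matrix.det_mul, Matrix.det_diagonal, Matrix.det_one_add_replicateCol_mul_replicateRow, h2]
  congr 1
  field_simp
  ring

/-- With `a² = 1 - s`: `1 - a²|x|² = (1 - s)(1 - |x|²) + s`. Contraction reads `a²(|p|² - (x·p)²) ≤
|p|² - a²(x·p)²`, which is `a² ≤ 1`. -/
theorem shrinking_ball (n : ℕ) : Shrinking (ι := Unit) (ball n) (ballMetric n) (ballInv n)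
    (fun _ x => 1 - ∑ k, x k ^ 2) (fun s => √(1 - ∑ i, s i)) (fun _ => 0) := by
  have hnorm : ∀ x : EuclideanSpace ℝ (Fin n), ∑ k, x k ^ 2 = ‖x‖ ^ 2 := fun x =>
    (EuclideanSpace.real_norm_sq_eq x).symm
  have hmem : ∀ x, x ∈ ball n ↔ ∀ _ : Unit, 0 < 1 - ∑ k, x k ^ 2 := fun x => by
    simp only [ball, Set.mem_ofPred_eq, forall_const, hnorm, sub_pos]
    exact (sq_lt_one_iff₀ (norm_nonneg x)).symm
  refine ⟨fun _ => by fun_prop, ?_, hmem, ?_, ?_, ?_, ?_, by fun_prop, by fun_prop, by simp,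
    rfl, ?_, ?_⟩
  · refine Metric.isBounded_closedBall (x := (0 : EuclideanSpace ℝ (Fin n))) (r := 1) |>.subset ?_
    intro x hx
    have := hx ()
    rw [hnorm, sub_nonneg] at this
    rw [mem_closedBall_zero_iff]
    exact (sq_le_one_iff₀ (norm_nonneg x)).1 this
  · intro x hx
    have := (hmem x).1 hx ()
    rw [det_ballMetric this.ne', Real.sqrt_inv]
    simp
  · exact continuous_matrix fun i j => by
      simp only [ballInv, Matrix.of_apply]
      fun_prop
  · intro x hx
    exact ballMetric_mul_ballInv ((hmem x).1 hx ()).ne'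
  · intro x hx p
    have h1 := (hmem x).1 hx ()
    have h2 := Finset.sum_mul_sq_le_sq_mul_sq Finset.univ (fun i => x i) p
    have h3 : 0 ≤ ∑ i, p i ^ 2 := Finset.sum_nonneg fun i _ => sq_nonneg _
    rw [dotProduct_ballInv]
    nlinarith
  · intro s hs hs1 i x
    have h : √(1 - ∑ i, s i) ^ 2 = 1 - ∑ i, s i := Real.sq_sqrt (by linarith)
    have : ∑ k, (√(1 - ∑ i, s i) • x + 0) k ^ 2 = (1 - ∑ i, s i) * ∑ k, x k ^ 2 := by
      rw [← h, Finset.mul_sum]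
      refine Finset.sum_congr rfl fun k _ => ?_
      simp [mul_pow]
    rw [this]
    simp only [Finset.univ_unique, Finset.sum_singleton]
    have : s default = s i := rfl
    rw [this]
    ring
  · intro s hs hs1 x hx p
    have h : √(1 - ∑ i, s i) ^ 2 = 1 - ∑ i, s i := Real.sq_sqrt (by linarith)
    have h0 : 0 ≤ ∑ i, s i := Finset.sum_nonneg fun i _ => hs i
    have h3 : 0 ≤ ∑ i, p i ^ 2 := Finset.sum_nonneg fun i _ => sq_nonneg _
    have h4 : ∑ i, (√(1 - ∑ i, s i) • x + 0) i * p i = √(1 - ∑ i, s i) * ∑ i, x i * p i := by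
      rw [Finset.mul_sum]
      refine Finset.sum_congr rfl fun k _ => ?_
      simp [mul_assoc]
    rw [dotProduct_ballInv, dotProduct_ballInv, h4, mul_pow, h]
    nlinarith

/-- In barycentric coordinates, indexed by `Option (Fin n)` with `none` for `1 - ∑ x k`, the map is
`λ ↦ (1 - σ) λ + s` with `σ = ∑ s`, so all faces are treated alike. -/
theorem shrinking_simplex (n : ℕ) : Shrinking (ι := Option (Fin n)) (simplex n) (simplexMetric n)
    (simplexInv n) (fun o x => o.elim (1 - ∑ k, x k) fun i => x i) (fun s => 1 - ∑ i, s i)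
    (fun s => WithLp.toLp 2 fun i => s (some i)) := by
  refine ⟨?_, ?_, ?_, ?_, ?_, ?_, ?_, by fun_prop, by fun_prop, by simp, rfl, ?_, ?_⟩
  · rintro (_ | i) <;> simp only [Option.elim] <;> fun_prop
  · refine Metric.isBounded_closedBall (x := (0 : EuclideanSpace ℝ (Fin n))) (r := 1) |>.subset ?_
    intro x hx
    have h0 : 0 ≤ 1 - ∑ k, x k := hx none
    have hi : ∀ i, 0 ≤ x i := fun i => hx (some i)
    have h1 : ∀ i, x i ≤ 1 := fun i => by
      have := Finset.single_le_sum (f := fun i => x i) (fun i _ => hi i) (Finset.mem_univ i)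
      simp only at this
      linarith
    rw [mem_closedBall_zero_iff, ← sq_le_one_iff₀ (norm_nonneg x), EuclideanSpace.real_norm_sq_eq]
    calc ∑ i, x i ^ 2 ≤ ∑ i, x i := Finset.sum_le_sum fun i _ => by nlinarith [hi i, h1 i]
      _ ≤ 1 := by linarith
  · intro x
    simp only [simplex, Set.mem_ofPred_eq, Option.forall, Option.elim, sub_pos]
    exact and_comm
  · rintro x ⟨hx, hx'⟩
    rw [det_simplexMetric (fun i => (hx i).ne') (by linarith),
      Real.sqrt_mul (Finset.prod_nonneg fun i _ => inv_nonneg.2 (hx i).le), Real.sqrt_inv,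
      Real.sqrt_prod _ fun i _ => inv_nonneg.2 (hx i).le, Fintype.prod_option, mul_comm]
    simp [Real.sqrt_inv]
  · exact continuous_matrix fun i j => by
      simp only [simplexInv, Matrix.of_apply]
      split_ifs <;> fun_prop
  · rintro x ⟨hx, hx'⟩
    exact simplexMetric_mul_simplexInv (fun i => (hx i).ne') (by linarith)
  · rintro x ⟨hx, hx'⟩ p
    have h2 := sq_sum_mul_le (fun i => (hx i).le) p
    have h3 : 0 ≤ ∑ i, x i * p i ^ 2 :=
      Finset.sum_nonneg fun i _ => mul_nonneg (hx i).le (sq_nonneg _)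
    rw [dotProduct_simplexInv]
    nlinarith
  · rintro s hs hs1 (_ | i) x
    · simp only [Option.elim, PiLp.add_apply, PiLp.smul_apply, smul_eq_mul,
        Finset.sum_add_distrib, ← Finset.mul_sum, Fintype.sum_option]
      ring
    · simp
  · rintro s hs hs1 x ⟨hx, hx'⟩ p
    rw [dotProduct_simplexInv, dotProduct_simplexInv]
    have h1 := sq_sum_mul_le (fun i => (hx i).le) p
    have h2 := sq_sum_mul_le (fun i => hs (some i)) p
    have h3 : 0 ≤ ∑ i, x i * p i ^ 2 :=
      Finset.sum_nonneg fun i _ => mul_nonneg (hx i).le (sq_nonneg _)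
    have h4 : 0 ≤ ∑ i, s (some i) * p i ^ 2 :=
      Finset.sum_nonneg fun i _ => mul_nonneg (hs _) (sq_nonneg _)
    have h5 : 0 ≤ ∑ i, s i := Finset.sum_nonneg fun i _ => hs i
    have h6 : ∑ i, s (some i) ≤ ∑ i, s i := by
      rw [Fintype.sum_option]; linarith [hs none]
    simp only [PiLp.add_apply, PiLp.smul_apply, smul_eq_mul, add_mul, mul_assoc,
      Finset.sum_add_distrib, ← Finset.mul_sum]
    set P := ∑ i, x i * p i ^ 2
    set B := ∑ i, x i * p i
    set S := ∑ i, s (some i) * p i ^ 2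
    set D := ∑ i, s (some i) * p i
    set σ := ∑ i, s i
    have hB : B ^ 2 ≤ P := by nlinarith
    have hD : D ^ 2 ≤ σ * S := h2.trans (by gcongr)
    -- The inequality is proved after multiplication by `σ`, so `σ = 0` is separate. For `σ > 0`,
    -- the bounds `B² ≤ P` and `D² ≤ σ S` show that `σ` times the difference of the two sides is at
    -- least `(1 - σ)(σ B - D)²`.
    rcases h5.eq_or_lt with hσ | hσ
    · rw [← hσ] at hD ⊢
      have hD0 : D = 0 := by nlinarith
      rw [hD0]
      linarith
    · refine le_of_mul_le_mul_left ?_ hσ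
      nlinarith [mul_nonneg (mul_nonneg (sq_nonneg σ) (show 0 ≤ 1 - σ by linarith))
        (sub_nonneg.2 hB), mul_nonneg (show 0 ≤ 1 - σ by linarith) (sq_nonneg (σ * B - D))]

end Baran

theorem proposition2p3 (n : ℕ) (M : Set (EuclideanSpace ℝ (Fin n)))
    (G : EuclideanSpace ℝ (Fin n) → Matrix (Fin n) (Fin n) ℝ)
    (hMG : (M = Baran.ball n ∧ G = Baran.ballMetric n) ∨
      (M = Baran.simplex n ∧ G = Baran.simplexMetric n)) :
    Baran.CInftyB M ⊆ Baran.CInfty12 M G ∧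
    (∀ u ∈ Baran.CInfty12 M G, ∀ ε : ENNReal, 0 < ε →
      ∃ v ∈ Baran.CInftyB M, Baran.norm12 M G (u - v) < ε) ∧
    Baran.CInftyB M ⊆ Baran.H1 M G ∧
    (∀ u ∈ Baran.H1 M G, ∀ X, Baran.IsH1Gradient M G u X → ∀ ε : ENNReal, 0 < ε →
      ∃ v ∈ Baran.CInftyB M, Baran.pairNorm M G (u - v) (X - Baran.grad G v) < ε) := by
  obtain ⟨ι, _, A, ℓ, a, b, H⟩ : ∃ (ι : Type) (_ : Fintype ι)
      (A : EuclideanSpace ℝ (Fin n) → Matrix (Fin n) (Fin n) ℝ)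
      (ℓ : ι → EuclideanSpace ℝ (Fin n) → ℝ) (a : (ι → ℝ) → ℝ)
      (b : (ι → ℝ) → EuclideanSpace ℝ (Fin n)), Baran.Shrinking M G A ℓ a b := by
    rcases hMG with ⟨rfl, rfl⟩ | ⟨rfl, rfl⟩
    · exact ⟨_, _, _, _, _, _, Baran.shrinking_ball n⟩
    · exact ⟨_, _, _, _, _, _, Baran.shrinking_simplex n⟩
  exact ⟨H.CInftyB_subset, fun u hu ε hε => H.exists_norm12_sub_lt hu hε, H.CInftyB_subset_H1,
    fun u _ X hX ε hε => H.exists_pairNorm_sub_lt hX hε⟩
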